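/- Let $d\ge 2$ and let $\sigma$ be the surface measure on the unit sphere $\mathbb S^{d-1}\subset\mathbb R^d$. For $f\in L^1(\mathbb S^{d-1},\sigma)$ let $$\widehat{f\,d\sigma}(x)=\int_{\mathbb S^{d-1}} e^{-i x\cdot\omega} f(\omega)\,d\sigma(\omega),\qquad x\in\mathbb R^d .$$ For $0<p<\infty$ and a measurable function $f$ on a measure space $(X,\mu)$ put $\|f\|_{L^{p,1}}=p\int_0^\infty \mu(\{|f|>s\})^{1/p}\,ds$ and $\|f\|_{L^{p,\infty}}=\sup_{s>0}s\,\mu(\{|f|>s\})^{1/p}$. (i) For every $p$ with $\frac{2d}{d-1}<p<\infty$ the $L^{p,1}(\mathbb S^{d-1})\to L^{2d/(d-1),\infty}(\mathbb R^d)$ estimate for $f\mapsto\widehat{f\,d\sigma}$ fails: there is no constant $C<\infty$ such that $$\|\widehat{f\,d\sigma}\|_{L^{2d/(d-1),\infty}(\mathbb R^d)}\le C\,\|f\|_{L^{p,1}(\mathbb S^{d-1})}\qquad\text{for all } f\in L^{p,1}(\mathbb S^{d-1}).$$ (ii) For $p=\infty$, the $L^{\infty}(\mathbb S^{d-1})\to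 L^{2d/(d-1),\infty}(\mathbb R^d)$ estimate fails too: there is no constant $C<\infty$ such that $\|\widehat{f\,d\sigma}\|_{L^{2d/(d-1),\infty}(\mathbb R^d)}\le C\,\|f\|_{L^{\infty}(\mathbb S^{d-1})}$ for all $f\in L^\infty(\mathbb S^{d-1})$. (iii) In particular the stronger $L^{p,1}(\mathbb S^{d-1})\to L^{p,\infty}(\mathbb R^d)$ estimate with $p=\frac{2d}{d-1}$ fails (the result of Beckner, Carbery, Semmes and Soria). -/

import Mathlib

open MeasureTheory Set
open scoped ENNReal NNReal

noncomputable section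

/-- The distribution function `s ↦ μ {x : |f x| > s}`. -/
def distribFn {α E : Type*} [MeasurableSpace α] [ENorm E] (f : α → E) (μ : Measure α)
    (s : ℝ≥0∞) : ℝ≥0∞ :=
  μ {x | s < ‖f x‖ₑ}

/-- The Lorentz (quasi-)norm of `L^{p,q}(μ)` for `0 < p < ∞` and `0 < q ≤ ∞`, written with the
distribution function `d`:
`p^{1/q} (∫₀^∞ (s d(s)^{1/p})^q ds/s)^{1/q}` for `q < ∞`, and `sup_{s > 0} s d(s)^{1/p}` for
`q = ∞`.  This equals the norm `‖t^{1/p} f^*(t)‖_{L^q(dt/t)}` of the decreasing rearrangement. -/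
def eLorentzNorm {α E : Type*} [MeasurableSpace α] [ENorm E] (f : α → E) (p : ℝ) (q : ℝ≥0∞)
    (μ : Measure α) : ℝ≥0∞ :=
  if q = ∞ then ⨆ s : ℝ≥0, (s : ℝ≥0∞) * distribFn f μ s ^ (1 / p)
  else ENNReal.ofReal p ^ (1 / q.toReal) *
    (∫⁻ s in Ioi (0 : ℝ),
      (ENNReal.ofReal s * distribFn f μ (ENNReal.ofReal s) ^ (1 / p)) ^ q.toReal
        / ENNReal.ofReal s) ^ (1 / q.toReal)

/-- Membership in the Lorentz space `L^{p,q}(μ)`. -/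
def MemLorentz {α E : Type*} [MeasurableSpace α] [TopologicalSpace E] [ENorm E] (f : α → E)
    (p : ℝ) (q : ℝ≥0∞) (μ : Measure α) : Prop :=
  AEStronglyMeasurable f μ ∧ eLorentzNorm f p q μ < ∞

/-- The unit sphere `S^{d-1}` of `ℝ^d`. -/
abbrev UnitSphere (d : ℕ) : Type :=
  Metric.sphere (0 : EuclideanSpace ℝ (Fin d)) 1

/-- The surface measure `σ` on `S^{d-1}` (not normalized). -/
def surfaceMeasure (d : ℕ) : Measure (UnitSphere d) :=
  (volume : Measure (EuclideanSpace ℝ (Fin d))).toSphere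

/-- The extension operator `f ↦ \widehat{f dσ}`, `x ↦ ∫ e^{-i x·ω} f(ω) dσ(ω)`. -/
def extensionOp (d : ℕ) (f : UnitSphere d → ℂ) (x : EuclideanSpace ℝ (Fin d)) : ℂ :=
  ∫ ω, Complex.exp (-Complex.I * (inner ℝ x (ω : EuclideanSpace ℝ (Fin d)) : ℝ)) * f ω
    ∂(surfaceMeasure d)

/-- The `L^{p,1}(S^{d-1}) → L^{q,∞}(ℝ^d)` estimate for the extension operator. -/
def LorentzExtensionEstimate (d : ℕ) (p q : ℝ) : Prop :=
  ∃ C : ℝ≥0, ∀ f : UnitSphere d → ℂ, MemLorentz f p 1 (surfaceMeasure d) →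
    eLorentzNorm (extensionOp d f) q ∞ volume ≤ C * eLorentzNorm f p 1 (surfaceMeasure d)

/-- The `L^∞(S^{d-1}) → L^{q,∞}(ℝ^d)` estimate for the extension operator. -/
def BoundedExtensionEstimate (d : ℕ) (q : ℝ) : Prop :=
  ∃ C : ℝ≥0, ∀ f : UnitSphere d → ℂ, MemLp f ∞ (surfaceMeasure d) →
    eLorentzNorm (extensionOp d f) q ∞ volume ≤ C * eLpNorm f ∞ (surfaceMeasure d)

end

/-!
All three estimates fail because the estimate on `L^∞` does: on a finite measure space the `L^{p,1}`
norm of a function bounded by one is bounded (`eLorentzNorm_one_le_of_norm_le_one`).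

For `L^∞` the obstruction is a Besicovitch set. Put `δ = 2⁻ⁿ` and cut part of the sphere into
`δ^{-(d-1)}` disjoint caps of diameter comparable to `δ`. The extension of the indicator function of
a cap is, without cancellation, of size the measure of the cap on a dual tube of length `L` and
width `L δ`, where `L` is comparable to `δ⁻²`, and modulating the indicator function translates the
tube (`measureReal_le_norm_extensionOp_modulated`, `abs_inner_tube_cap_le_one`). Adding the modulated
pieces with suitable signs gives a function `F` bounded by one such that the square integral of its
extension over the union `K` of the tubes is at least the sum of the contributions of the individual
tubes, which is comparable to `L` (`exists_signed_sum_extensionOp`, a deterministic replacement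
for Khintchine's inequality).

On the other hand the tubes can be placed so that `|K| ≤ ε L^d` with `ε → 0` as `n → ∞`. In the plane
the line of slope `x ∈ [0, 1)`, a dyadic rational with `n` digits, is given the intercept
`-(1/n) ∑ (x - xᵢ)`, where `xᵢ` consists of the first `i` digits of `x`; at height about `k / n` the
dependence on the digits after the `k`-th one nearly cancels, so that the lines occupy only `2ᵏ`
intervals of length about `2⁻ᵏ / n` (`abs_line_sub_le`, `volume_besicovitchSlice_le`). In higher
dimension the same intercept is used in each coordinate (`volume_iUnion_besicovitchTube_le`).

With `q = 2d/(d-1)`, a bound `A` for the `L^{q,∞}` norm of the extension of `F` gives by the layer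
cake formula a bound `L (τ² ε + C A^q τ^{-2/(d-1)})` for the square integral over `K`, for every
`τ > 0` (`setLIntegral_norm_sq_le_of_weak`). Letting first `ε → 0` and then `τ → ∞` contradicts the
lower bound.
-/

noncomputable section

/-! ### Weak-type bounds and local square integrals -/

/-- A weak-type bound controls the square integral over a set of finite measure: the part of the
function below the height `s₀` is bounded trivially, the part above by the layer cake formula. -/
theorem setLIntegral_norm_sq_le_of_weak {α : Type*} [MeasurableSpace α] {μ : Measure α}
    {g : α → ℂ} (hg : Measurable g) {q A s₀ : ℝ} (hq : 2 < q) (hA : 0 ≤ A)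
    (hs₀ : 0 < s₀) (h : ∀ s : ℝ, 0 < s → μ {x | s < ‖g x‖} ≤ ENNReal.ofReal (A * s ^ (-q)))
    (K : Set α) :
    ∫⁻ x in K, ENNReal.ofReal (‖g x‖ ^ 2) ∂μ ≤
      ENNReal.ofReal (s₀ ^ 2) * μ K + ENNReal.ofReal (2 / (q - 2) * A * s₀ ^ (2 - q)) := by
  have hcake := lintegral_rpow_eq_lintegral_meas_lt_mul (μ := μ.restrict K)
    (f := fun x => ‖g x‖) (Filter.Eventually.of_forall fun x => norm_nonneg _)
    hg.norm.aemeasurable (p := 2) two_pos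
  simp only [Real.rpow_two] at hcake
  rw [hcake, ← Ioc_union_Ioi_eq_Ioi hs₀.le,
    lintegral_union measurableSet_Ioi (Ioc_disjoint_Ioi le_rfl), mul_add]
  have hlow : ∫⁻ t in Ioc 0 s₀, ENNReal.ofReal (t ^ ((2 : ℝ) - 1)) =
      ENNReal.ofReal (s₀ ^ 2 / 2) := by
    rw [← ofReal_integral_eq_lintegral_ofReal]
    · rw [← intervalIntegral.integral_of_le hs₀.le]
      congr 1
      norm_num
    · refine (intervalIntegrable_iff_integrableOn_Ioc_of_le hs₀.le).1 ?_
      apply intervalIntegral.intervalIntegrable_rpow'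
      norm_num
    · filter_upwards [ae_restrict_mem measurableSet_Ioc] with t ht
      exact Real.rpow_nonneg ht.1.le _
  have hhigh : ∫⁻ t in Ioi s₀, ENNReal.ofReal (A * t ^ (1 - q)) =
      ENNReal.ofReal (A * (s₀ ^ (2 - q) / (q - 2))) := by
    rw [← ofReal_integral_eq_lintegral_ofReal]
    · rw [integral_const_mul, integral_Ioi_rpow_of_lt (by linarith) hs₀]
      congr 2
      rw [show 1 - q + 1 = 2 - q by ring, ← neg_sub q 2, neg_div_neg_eq]
    · exact (integrableOn_Ioi_rpow_of_lt (by linarith) hs₀).const_mul A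
    · filter_upwards [ae_restrict_mem measurableSet_Ioi] with t ht
      exact mul_nonneg hA (Real.rpow_nonneg (hs₀.trans ht).le _)
  gcongr ?_ + ?_
  · calc ENNReal.ofReal 2 * ∫⁻ t in Ioc 0 s₀, μ.restrict K {a | t < ‖g a‖} *
          ENNReal.ofReal (t ^ ((2 : ℝ) - 1))
        ≤ ENNReal.ofReal 2 * ∫⁻ t in Ioc 0 s₀, μ K * ENNReal.ofReal (t ^ ((2 : ℝ) - 1)) := by
          refine mul_le_mul_right (lintegral_mono fun t => mul_le_mul_left ?_ _) _
          exact (measure_mono (subset_univ _)).trans_eq (Measure.restrict_apply_univ K)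
      _ = ENNReal.ofReal (s₀ ^ 2) * μ K := by
          rw [lintegral_const_mul _ (by fun_prop), hlow, mul_left_comm,
            ← ENNReal.ofReal_mul two_pos.le, mul_comm (μ K)]
          congr 2
          ring
  · calc ENNReal.ofReal 2 * ∫⁻ t in Ioi s₀, μ.restrict K {a | t < ‖g a‖} *
          ENNReal.ofReal (t ^ ((2 : ℝ) - 1))
        ≤ ENNReal.ofReal 2 * ∫⁻ t in Ioi s₀, ENNReal.ofReal (A * t ^ (1 - q)) := by
          gcongr 1
          refine setLIntegral_mono' measurableSet_Ioi fun t ht => ?_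
          have ht0 : 0 < t := hs₀.trans ht
          calc μ.restrict K {a | t < ‖g a‖} * ENNReal.ofReal (t ^ ((2 : ℝ) - 1))
              ≤ ENNReal.ofReal (A * t ^ (-q)) * ENNReal.ofReal (t ^ ((2 : ℝ) - 1)) := by
                gcongr
                exact (Measure.restrict_apply_le _ _).trans (h t ht0)
            _ = ENNReal.ofReal (A * t ^ (1 - q)) := by
                rw [← ENNReal.ofReal_mul (by positivity), mul_assoc, ← Real.rpow_add ht0]
                congr 3
                ring
      _ = ENNReal.ofReal (2 / (q - 2) * A * s₀ ^ (2 - q)) := by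
          rw [hhigh, ← ENNReal.ofReal_mul two_pos.le]
          congr 1
          ring

/-- The distributional form of a bound on the `L^{q,∞}` norm. -/
theorem measure_lt_norm_le_of_eLorentzNorm_top_le {α : Type*} [MeasurableSpace α] {μ : Measure α}
    {g : α → ℂ} {q : ℝ} (hq : 0 < q) {A : ℝ≥0} (h : eLorentzNorm g q ∞ μ ≤ A)
    {s : ℝ} (hs : 0 < s) :
    μ {x | s < ‖g x‖} ≤ ENNReal.ofReal ((A : ℝ) ^ q * s ^ (-q)) := by
  have h1 : ENNReal.ofReal s * μ {x | s < ‖g x‖} ^ (1 / q) ≤ A := by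
    rw [eLorentzNorm, if_pos rfl] at h
    refine le_trans (le_of_eq ?_) ((le_iSup _ s.toNNReal).trans h)
    simp only [distribFn, ENNReal.ofReal]
    congr 3
    ext x
    simp only [mem_ofPred_eq, ← enorm_norm (g x)]
    rw [Real.enorm_eq_ofReal (norm_nonneg _), ← ENNReal.ofReal,
      ENNReal.ofReal_lt_ofReal_iff_of_nonneg hs.le]
  have h2 : μ {x | s < ‖g x‖} ^ (1 / q) ≤ ENNReal.ofReal (A / s) := by
    rw [ENNReal.ofReal_div_of_pos hs, ENNReal.ofReal_coe_nnreal]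
    rw [ENNReal.le_div_iff_mul_le (by simp [hs]) (by simp), mul_comm]
    exact h1
  calc μ {x | s < ‖g x‖} = (μ {x | s < ‖g x‖} ^ (1 / q)) ^ q := by
        rw [← ENNReal.rpow_mul, one_div_mul_cancel hq.ne', ENNReal.rpow_one]
    _ ≤ ENNReal.ofReal (A / s) ^ q := by gcongr
    _ = _ := by
        rw [ENNReal.ofReal_rpow_of_nonneg (by positivity) hq.le,
          Real.div_rpow (by positivity) hs.le, Real.rpow_neg hs.le, div_eq_mul_inv]

/-- On a finite measure space the `L^{p,1}` norm of a function bounded by one is at most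
`p · μ(univ)^{1/p}`. -/
theorem eLorentzNorm_one_le_of_norm_le_one {α : Type*} [MeasurableSpace α] {μ : Measure α}
    {f : α → ℂ} {p : ℝ} (hp : 0 < p) (hf : ∀ x, ‖f x‖ ≤ 1) :
    eLorentzNorm f p 1 μ ≤ ENNReal.ofReal p * μ univ ^ (1 / p) := by
  rw [eLorentzNorm, if_neg ENNReal.one_ne_top]
  simp only [ENNReal.toReal_one, div_one, ENNReal.rpow_one]
  gcongr
  have hpos : ∀ s ∈ Ioi (0 : ℝ), ENNReal.ofReal s *
      distribFn f μ (ENNReal.ofReal s) ^ (1 / p) / ENNReal.ofReal s ≤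
      (Ioo (0 : ℝ) 1).indicator (fun _ => μ univ ^ (1 / p)) s := by
    intro s hs
    rw [mem_Ioi] at hs
    rw [mul_comm, ENNReal.mul_div_cancel_right (by simp [hs]) (by simp)]
    by_cases h1 : s < 1
    · rw [indicator_of_mem (show s ∈ Ioo (0 : ℝ) 1 from ⟨hs, h1⟩)]
      unfold distribFn
      gcongr
      exact subset_univ _
    · have : distribFn f μ (ENNReal.ofReal s) = 0 := by
        unfold distribFn
        convert measure_empty (μ := μ)
        ext x
        simp only [mem_ofPred_eq, mem_empty_iff_false, iff_false, not_lt, ← enorm_norm (f x)]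
        rw [Real.enorm_eq_ofReal (norm_nonneg _)]
        exact ENNReal.ofReal_le_ofReal ((hf x).trans (not_lt.1 h1))
      rw [this, ENNReal.zero_rpow_of_pos (by positivity)]
      exact zero_le
  calc _ ≤ ∫⁻ s in Ioi (0 : ℝ), (Ioo (0 : ℝ) 1).indicator (fun _ => μ univ ^ (1 / p)) s :=
        setLIntegral_mono' measurableSet_Ioi hpos
    _ ≤ ∫⁻ s, (Ioo (0 : ℝ) 1).indicator (fun _ => μ univ ^ (1 / p)) s :=
        setLIntegral_le_lintegral _ _
    _ = _ := by simp [lintegral_indicator measurableSet_Ioo]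

/-! ### The extension operator and choice of signs -/

theorem measurable_exp_mul {d : ℕ} {f : UnitSphere d → ℂ} (hf : Measurable f)
    (x : EuclideanSpace ℝ (Fin d)) :
    Measurable fun ω : UnitSphere d =>
      Complex.exp (-Complex.I * (inner ℝ x (ω : EuclideanSpace ℝ (Fin d)) : ℝ)) * f ω := by
  refine Measurable.mul (Continuous.measurable ?_) hf
  fun_prop

theorem norm_exp_neg_I_mul (r : ℝ) : ‖Complex.exp (-Complex.I * (r : ℝ))‖ = 1 := by
  rw [Complex.norm_exp]
  simp

theorem integrable_exp_mul {d : ℕ} {f : UnitSphere d → ℂ} (hf : Measurable f)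
    (hf1 : ∀ ω, ‖f ω‖ ≤ 1) (x : EuclideanSpace ℝ (Fin d)) :
    Integrable (fun ω : UnitSphere d =>
      Complex.exp (-Complex.I * (inner ℝ x (ω : EuclideanSpace ℝ (Fin d)) : ℝ)) * f ω)
      (surfaceMeasure d) := by
  have : IsFiniteMeasure (surfaceMeasure d) := by unfold surfaceMeasure; infer_instance
  refine Integrable.of_bound (measurable_exp_mul hf x).aestronglyMeasurable 1
    (Filter.Eventually.of_forall fun ω => ?_)
  rw [norm_mul, norm_exp_neg_I_mul, one_mul]
  exact hf1 ω

theorem continuous_extensionOp {d : ℕ} {f : UnitSphere d → ℂ} (hf : Measurable f)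
    (hf1 : ∀ ω, ‖f ω‖ ≤ 1) : Continuous (extensionOp d f) := by
  have : IsFiniteMeasure (surfaceMeasure d) := by unfold surfaceMeasure; infer_instance
  refine continuous_of_dominated (bound := fun _ => 1)
    (fun x => (measurable_exp_mul hf x).aestronglyMeasurable)
    (fun x => Filter.Eventually.of_forall fun ω => ?_) (integrable_const _)
    (Filter.Eventually.of_forall fun ω => ?_)
  · rw [norm_mul, norm_exp_neg_I_mul, one_mul]
    exact hf1 ω
  · fun_prop

theorem exists_sign_add_le_lintegral {α : Type*} [MeasurableSpace α] {μ : Measure α}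
    {F G : α → ℂ} (hF : Measurable F) (hG : Measurable G) :
    (∫⁻ x, ENNReal.ofReal (‖F x‖ ^ 2) ∂μ) + ∫⁻ x, ENNReal.ofReal (‖G x‖ ^ 2) ∂μ ≤
        ∫⁻ x, ENNReal.ofReal (‖F x + G x‖ ^ 2) ∂μ ∨
      (∫⁻ x, ENNReal.ofReal (‖F x‖ ^ 2) ∂μ) + ∫⁻ x, ENNReal.ofReal (‖G x‖ ^ 2) ∂μ ≤
        ∫⁻ x, ENNReal.ofReal (‖F x - G x‖ ^ 2) ∂μ := by
  by_contra! hcon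
  have hlt := ENNReal.add_lt_add hcon.1 hcon.2
  refine hlt.ne ?_
  rw [← lintegral_add_left (by fun_prop), ← lintegral_add_left (by fun_prop),
    ← lintegral_add_left (by fun_prop)]
  refine lintegral_congr fun x => ?_
  simp only [← ENNReal.ofReal_add (sq_nonneg _) (sq_nonneg _),
    ← ENNReal.ofReal_add (add_nonneg (sq_nonneg _) (sq_nonneg _))
      (add_nonneg (sq_nonneg _) (sq_nonneg _))]
  congr 1
  have := parallelogram_law_with_norm ℝ (F x) (G x)
  nlinarith [this]

/-- Functions with disjoint supports, each bounded by one, can be added with signs so that the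
square functions of their extensions add up: by the parallelogram law one of the two signs is
good at each step. -/
theorem exists_signed_sum_extensionOp {d : ℕ} {ι : Type*}
    (f : ι → UnitSphere d → ℂ) (hf : ∀ j, Measurable (f j)) (hf1 : ∀ j ω, ‖f j ω‖ ≤ 1)
    (hdisj : ∀ i j, i ≠ j → ∀ ω, f i ω = 0 ∨ f j ω = 0)
    (K : Set (EuclideanSpace ℝ (Fin d))) (J : Finset ι) :
    ∃ F : UnitSphere d → ℂ, Measurable F ∧ (∀ ω, ‖F ω‖ ≤ 1) ∧
      ∑ j ∈ J, ∫⁻ x in K, ENNReal.ofReal (‖extensionOp d (f j) x‖ ^ 2) ≤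
        ∫⁻ x in K, ENNReal.ofReal (‖extensionOp d F x‖ ^ 2) := by
  classical
  suffices h : ∃ F : UnitSphere d → ℂ, Measurable F ∧ (∀ ω, ‖F ω‖ ≤ 1) ∧
      (∀ ω, (∀ j ∈ J, f j ω = 0) → F ω = 0) ∧
      ∑ j ∈ J, ∫⁻ x in K, ENNReal.ofReal (‖extensionOp d (f j) x‖ ^ 2) ≤
        ∫⁻ x in K, ENNReal.ofReal (‖extensionOp d F x‖ ^ 2) by
    obtain ⟨F, h1, h2, -, h3⟩ := h
    exact ⟨F, h1, h2, h3⟩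
  induction J using Finset.induction_on with
  | empty => exact ⟨0, measurable_zero, by simp, by simp, by simp⟩
  | insert a J ha ih =>
    obtain ⟨F, hF, hF1, hF0, hFJ⟩ := ih
    have hsep : ∀ ω, F ω = 0 ∨ f a ω = 0 := by
      intro ω
      by_cases hω : f a ω = 0
      · exact Or.inr hω
      · refine Or.inl (hF0 ω fun j hj => ?_)
        exact (hdisj j a (fun hja => ha (hja ▸ hj)) ω).resolve_right hω
    have hadd : ∀ x, extensionOp d (F + f a) x = extensionOp d F x + extensionOp d (f a) x := by
      intro x
      simp only [extensionOp, Pi.add_apply, mul_add]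
      exact integral_add (integrable_exp_mul hF hF1 x) (integrable_exp_mul (hf a) (hf1 a) x)
    have hsub : ∀ x, extensionOp d (F - f a) x = extensionOp d F x - extensionOp d (f a) x := by
      intro x
      simp only [extensionOp, Pi.sub_apply, mul_sub]
      exact integral_sub (integrable_exp_mul hF hF1 x) (integrable_exp_mul (hf a) (hf1 a) x)
    rcases exists_sign_add_le_lintegral (μ := volume.restrict K)
      (continuous_extensionOp hF hF1).measurable
      (continuous_extensionOp (hf a) (hf1 a)).measurable with h | h
    · refine ⟨F + f a, hF.add (hf a), fun ω => ?_, fun ω hω => ?_, ?_⟩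
      · rcases hsep ω with h0 | h0 <;> simp [h0, hF1, hf1]
      · simp [hF0 ω fun j hj => hω j (Finset.mem_insert_of_mem hj),
          hω a (Finset.mem_insert_self _ _)]
      · rw [Finset.sum_insert ha, add_comm]
        simp only [hadd]
        exact (add_le_add_left hFJ _).trans h
    · refine ⟨F - f a, hF.sub (hf a), fun ω => ?_, fun ω hω => ?_, ?_⟩
      · rcases hsep ω with h0 | h0 <;> simp [h0, hF1, hf1]
      · simp [hF0 ω fun j hj => hω j (Finset.mem_insert_of_mem hj),
          hω a (Finset.mem_insert_self _ _)]
      · rw [Finset.sum_insert ha, add_comm]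
        simp only [hsub]
        exact (add_le_add_left hFJ _).trans h

/-- If the phase `⟨x - b, ω⟩` varies by at most one over `Q`, then there is no cancellation in the
extension of `1_Q` modulated to have focus at `b`. -/
theorem measureReal_le_norm_extensionOp_modulated {d : ℕ} {Q : Set (UnitSphere d)}
    (hQ : MeasurableSet Q) (b x e : EuclideanSpace ℝ (Fin d))
    (h : ∀ ω ∈ Q, |inner ℝ (x - b) ((ω : EuclideanSpace ℝ (Fin d)) - e)| ≤ 1) :
    (surfaceMeasure d).real Q / 2 ≤ ‖extensionOp d (Q.indicator fun ω =>
      Complex.exp (Complex.I * (inner ℝ b (ω : EuclideanSpace ℝ (Fin d)) : ℝ))) x‖ := by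
  have : IsFiniteMeasure (surfaceMeasure d) := by unfold surfaceMeasure; infer_instance
  set z : ℂ := Complex.exp (Complex.I * (inner ℝ (x - b) e : ℝ)) with hz
  have hz1 : ‖z‖ = 1 := by
    rw [hz, Complex.norm_exp]
    simp
  have hkey : z * extensionOp d (Q.indicator fun ω =>
      Complex.exp (Complex.I * (inner ℝ b (ω : EuclideanSpace ℝ (Fin d)) : ℝ))) x =
      ∫ ω in Q, Complex.exp (-Complex.I *
        (inner ℝ (x - b) ((ω : EuclideanSpace ℝ (Fin d)) - e) : ℝ)) ∂(surfaceMeasure d) := by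
    rw [extensionOp, ← integral_const_mul, ← integral_indicator hQ]
    refine integral_congr_ae (Filter.Eventually.of_forall fun ω => ?_)
    by_cases hω : ω ∈ Q
    · simp only [indicator_of_mem hω, hz, ← Complex.exp_add]
      congr 1
      simp only [inner_sub_left, inner_sub_right]
      push_cast
      ring
    · simp [indicator_of_notMem hω]
  have hint : Integrable (fun ω : UnitSphere d => Complex.exp (-Complex.I *
        (inner ℝ (x - b) ((ω : EuclideanSpace ℝ (Fin d)) - e) : ℝ)))
        ((surfaceMeasure d).restrict Q) := by
    refine Integrable.of_bound (Continuous.aestronglyMeasurable (by fun_prop)) 1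
      (Filter.Eventually.of_forall fun ω => (norm_exp_neg_I_mul _).le)
  calc (surfaceMeasure d).real Q / 2 = ∫ ω in Q, (1 / 2 : ℝ) ∂(surfaceMeasure d) := by
        simp [div_eq_mul_inv]
    _ ≤ ∫ ω in Q, (Complex.exp (-Complex.I *
        (inner ℝ (x - b) ((ω : EuclideanSpace ℝ (Fin d)) - e) : ℝ))).re
          ∂(surfaceMeasure d) := by
        refine setIntegral_mono_on (integrable_const _) hint.re hQ fun ω hω => ?_
        have h1 := h ω hω
        rw [neg_mul, mul_comm, ← neg_mul, ← Complex.ofReal_neg, Complex.exp_ofReal_mul_I_re,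
          Real.cos_neg]
        have h2 := Real.one_sub_sq_div_two_le_cos
          (x := inner ℝ (x - b) ((ω : EuclideanSpace ℝ (Fin d)) - e))
        have h3 := (sq_le_one_iff_abs_le_one _).2 h1
        linarith
    _ = (∫ ω in Q, Complex.exp (-Complex.I *
        (inner ℝ (x - b) ((ω : EuclideanSpace ℝ (Fin d)) - e) : ℝ))
          ∂(surfaceMeasure d)).re := integral_re hint
    _ ≤ ‖∫ ω in Q, Complex.exp (-Complex.I *
        (inner ℝ (x - b) ((ω : EuclideanSpace ℝ (Fin d)) - e) : ℝ))
          ∂(surfaceMeasure d)‖ := Complex.re_le_norm _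
    _ = _ := by rw [← hkey, norm_mul, hz1, one_mul]

/-! ### Dyadic lines that compress -/

/-- The truncation of `j / 2 ^ n ∈ [0, 1)` to its first `i` binary digits, for `i ≤ n`. -/
def dyadicTrunc (n i j : ℕ) : ℝ := ((j / 2 ^ (n - i) : ℕ) : ℝ) / 2 ^ i

/-- The intercept of the line with slope `x = j / 2 ^ n`: minus the average of the errors made by
truncating `x` to its first `1, …, n` binary digits. -/
def besicovitchShift (n j : ℕ) : ℝ :=
  -(∑ i ∈ Finset.range n, ((j : ℝ) / 2 ^ n - dyadicTrunc n (i + 1) j)) / n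

/-- The slice at height `t` of the `2⁻ⁿ`-neighbourhood of the lines
`y = t x + besicovitchShift`, `x = j / 2 ^ n`. -/
def besicovitchSlice (n : ℕ) (t : ℝ) : Set ℝ :=
  ⋃ j : Fin (2 ^ n), Icc (t * ((j : ℕ) / 2 ^ n) + besicovitchShift n j - (2 ^ n)⁻¹)
    (t * ((j : ℕ) / 2 ^ n) + besicovitchShift n j + (2 ^ n)⁻¹)

theorem dyadicTrunc_error_mem_Ico {n i : ℕ} (hi : i ≤ n) (j : ℕ) :
    (j : ℝ) / 2 ^ n - dyadicTrunc n i j ∈ Ico (0 : ℝ) (2 ^ i)⁻¹ := by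
  have hpow : (2 : ℝ) ^ n = 2 ^ i * 2 ^ (n - i) := by
    rw [← pow_add, Nat.add_sub_cancel' hi]
  have hle : ((j / 2 ^ (n - i) : ℕ) : ℝ) * 2 ^ (n - i) ≤ j := by
    exact_mod_cast Nat.div_mul_le_self j (2 ^ (n - i))
  have hlt : (j : ℝ) < ((j / 2 ^ (n - i) : ℕ) : ℝ) * 2 ^ (n - i) + 2 ^ (n - i) := by
    exact_mod_cast Nat.lt_div_mul_add (Nat.two_pow_pos (n - i))
  have h1 : (0 : ℝ) < 2 ^ i := by positivity
  have h2 : (0 : ℝ) < 2 ^ (n - i) := by positivity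
  have heq : (j : ℝ) / 2 ^ n - dyadicTrunc n i j =
      (j - ((j / 2 ^ (n - i) : ℕ) : ℝ) * 2 ^ (n - i)) / (2 ^ i * 2 ^ (n - i)) := by
    rw [hpow, dyadicTrunc]
    field_simp
  rw [heq]
  constructor
  · apply div_nonneg (by linarith) (by positivity)
  · rw [div_lt_iff₀ (by positivity), inv_mul_cancel_left₀ h1.ne']
    linarith

theorem dyadicTrunc_trunc {n k i : ℕ} (hi : i ≤ k) (hk : k ≤ n) (j : ℕ) :
    dyadicTrunc n i j = dyadicTrunc k i (j / 2 ^ (n - k)) := by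
  rw [dyadicTrunc, dyadicTrunc, Nat.div_div_eq_div_mul, ← pow_add]
  congr 5
  omega

theorem sum_half_pow_le (k s : ℕ) :
    ∑ i ∈ Finset.range s, ((2 : ℝ) ^ (k + i + 1))⁻¹ ≤ (2 ^ k)⁻¹ := by
  have h : ∀ s : ℕ, ∑ i ∈ Finset.range s, ((2 : ℝ) ^ (k + i + 1))⁻¹ =
      (2 ^ k)⁻¹ - (2 ^ (k + s))⁻¹ := by
    intro s
    induction s with
    | zero => simp
    | succ s ih =>
      rw [Finset.sum_range_succ, ih, ← add_assoc, pow_succ 2 (k + s)]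
      field_simp
      ring
  rw [h s]
  have : (0 : ℝ) < (2 ^ (k + s))⁻¹ := by positivity
  linarith

/-- Near height `k / n` the position of a line is determined, up to an error `2⁻ᵏ / n`, by the
first `k` binary digits of its slope: the contribution of the later digits through the slope is
cancelled by that of the first `k` terms of the intercept. -/
theorem abs_line_sub_le {n k : ℕ} (hn : 0 < n) (hk : k ≤ n) {t : ℝ} (ht : k ≤ t * n)
    (ht' : t * n ≤ k + 1) (j : ℕ) :
    |t * (j / 2 ^ n) + besicovitchShift n j -
      (t * (((j / 2 ^ (n - k) : ℕ) : ℝ) / 2 ^ k) -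
        (∑ i ∈ Finset.range k, (((j / 2 ^ (n - k) : ℕ) : ℝ) / 2 ^ k -
          dyadicTrunc k (i + 1) (j / 2 ^ (n - k)))) / n)| ≤ (2 ^ k)⁻¹ / n := by
  obtain ⟨s, rfl⟩ := Nat.exists_eq_add_of_le hk
  set n := k + s with hndef
  have hn0 : (0 : ℝ) < n := by exact_mod_cast hn
  set l := j / 2 ^ (n - k) with hl
  set r : ℝ := (j : ℝ) / 2 ^ n - (l : ℝ) / 2 ^ k with hr
  have hr01 : r ∈ Ico (0 : ℝ) (2 ^ k)⁻¹ := dyadicTrunc_error_mem_Ico hk j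
  set w : ℝ := ∑ i ∈ Finset.range s, ((j : ℝ) / 2 ^ n - dyadicTrunc n (k + i + 1) j) with hw
  have hw0 : 0 ≤ w := Finset.sum_nonneg fun i hi =>
    (dyadicTrunc_error_mem_Ico (by rw [Finset.mem_range] at hi; omega) j).1
  have hw1 : w ≤ (2 ^ k)⁻¹ := by
    refine (Finset.sum_le_sum fun i hi => ?_).trans (sum_half_pow_le k s)
    exact (dyadicTrunc_error_mem_Ico (by rw [Finset.mem_range] at hi; omega) j).2.le
  have hsum : ∑ i ∈ Finset.range n, ((j : ℝ) / 2 ^ n - dyadicTrunc n (i + 1) j) =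
      (∑ i ∈ Finset.range k, ((l : ℝ) / 2 ^ k - dyadicTrunc k (i + 1) l)) + k * r + w := by
    rw [hndef, Finset.sum_range_add, ← hndef, ← hw]
    congr 1
    rw [← sub_eq_iff_eq_add', ← Finset.sum_sub_distrib, ← nsmul_eq_mul, ← Finset.card_range k,
      ← Finset.sum_const, Finset.card_range]
    refine Finset.sum_congr rfl fun i hi => ?_
    rw [Finset.mem_range] at hi
    rw [dyadicTrunc_trunc (show i + 1 ≤ k by omega) hk]
    ring
  have heq : t * (j / 2 ^ n) + besicovitchShift n j -
      (t * ((l : ℝ) / 2 ^ k) -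
        (∑ i ∈ Finset.range k, ((l : ℝ) / 2 ^ k - dyadicTrunc k (i + 1) l)) / n) =
      ((t * n - k) * r - w) / n := by
    rw [besicovitchShift, hsum, hr]
    field_simp
    ring
  rw [heq, abs_div, abs_of_pos hn0]
  gcongr
  have h1 : (t * n - k) * r ≤ 1 * (2 ^ k)⁻¹ :=
    mul_le_mul (by linarith) hr01.2.le hr01.1 zero_le_one
  have h2 : 0 ≤ (t * n - k) * r := mul_nonneg (by linarith) hr01.1
  rw [abs_le]
  constructor <;> linarith

/-- The slices at heights `0 ≤ t ≤ 1/2` are small: at height about `k / n` they consist of `2ᵏ`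
short intervals, one for each initial segment of `k` binary digits. -/
theorem volume_besicovitchSlice_le {N : ℕ} (hN : 0 < N) {t : ℝ} (ht : t ∈ Icc (0 : ℝ) (1 / 2)) :
    volume (besicovitchSlice (2 * N) t) ≤ ENNReal.ofReal (3 / N) := by
  set n := 2 * N with hn
  have hN0 : (0 : ℝ) < N := by exact_mod_cast hN
  have hnN : (n : ℝ) = 2 * N := by rw [hn]; push_cast; ring
  set k := ⌊t * n⌋₊ with hk
  have htn : 0 ≤ t * n := mul_nonneg ht.1 (Nat.cast_nonneg n)
  have hk1 : (k : ℝ) ≤ t * n := Nat.floor_le htn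
  have hk2 : t * n ≤ k + 1 := (Nat.lt_floor_add_one _).le
  have hkN : k ≤ N := by
    have : (k : ℝ) ≤ N := by rw [hnN] at hk1; nlinarith [ht.2]
    exact_mod_cast this
  set c : ℕ → ℝ := fun l => t * ((l : ℝ) / 2 ^ k) -
    (∑ i ∈ Finset.range k, ((l : ℝ) / 2 ^ k - dyadicTrunc k (i + 1) l)) / n
  set ρ : ℝ := (2 ^ k)⁻¹ / n + (2 ^ n)⁻¹ with hρ
  have hsub : besicovitchSlice n t ⊆ ⋃ l ∈ Finset.range (2 ^ k), Icc (c l - ρ) (c l + ρ) := by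
    intro y hy
    obtain ⟨j, hj⟩ := mem_iUnion.1 hy
    have hjl : (j : ℕ) / 2 ^ (n - k) < 2 ^ k := by
      rw [Nat.div_lt_iff_lt_mul (Nat.two_pow_pos _), ← pow_add]
      convert j.2 using 2
      omega
    refine mem_biUnion (x := (j : ℕ) / 2 ^ (n - k)) (by simpa using hjl) ?_
    have hline := abs_le.1 (abs_line_sub_le (by omega) (by omega) hk1 hk2 (j : ℕ))
    simp only [c, hρ]
    constructor
    · linarith [hj.1, hline.1]
    · linarith [hj.2, hline.2]
  calc volume (besicovitchSlice n t)
      ≤ ∑ l ∈ Finset.range (2 ^ k), volume (Icc (c l - ρ) (c l + ρ)) :=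
        (measure_mono hsub).trans (measure_biUnion_finset_le _ _)
    _ = ENNReal.ofReal (2 ^ k * (2 * ρ)) := by
        simp only [Real.volume_Icc]
        rw [Finset.sum_congr rfl fun l _ => by rw [show c l + ρ - (c l - ρ) = 2 * ρ by ring],
          Finset.sum_const, Finset.card_range, nsmul_eq_mul,
          ENNReal.ofReal_mul (p := 2 ^ k) (by positivity), ENNReal.ofReal_pow (by norm_num)]
        norm_num
    _ ≤ ENNReal.ofReal (3 / N) := by
        apply ENNReal.ofReal_le_ofReal
        have hNpow : (N : ℝ) ≤ 2 ^ N := by exact_mod_cast Nat.lt_two_pow_self.le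
        have hkpow : (2 : ℝ) ^ k ≤ 2 ^ N := by gcongr; norm_num
        have h2 : (2 : ℝ) ^ k * (2 ^ n)⁻¹ ≤ 1 / N := by
          rw [hn, two_mul, pow_add, ← div_eq_mul_inv, div_le_div_iff₀ (by positivity) hN0, one_mul]
          gcongr
        have h1 : (2 : ℝ) ^ k * ((2 ^ k)⁻¹ / n) = 1 / (2 * N) := by
          rw [hnN]
          field_simp
        calc (2 : ℝ) ^ k * (2 * ρ) = 2 * (2 ^ k * ((2 ^ k)⁻¹ / n)) + 2 * (2 ^ k * (2 ^ n)⁻¹) := by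
              rw [hρ]; ring
          _ ≤ 2 * (1 / (2 * N)) + 2 * (1 / N) := by rw [h1]; gcongr
          _ = 3 / N := by field_simp; norm_num

/-! ### Tubes in Euclidean space -/

/-- Fubini's theorem for sets in Euclidean space, slicing by the first coordinate. -/
theorem volume_euclidean_eq_lintegral_slice {m : ℕ} {S : Set (EuclideanSpace ℝ (Fin (m + 1)))}
    (hS : MeasurableSet S) :
    volume S = ∫⁻ t : ℝ, volume {y : Fin m → ℝ |
      WithLp.toLp 2 (Fin.cons t y : Fin (m + 1) → ℝ) ∈ S} := by
  have h1 := (PiLp.volume_preserving_toLp (Fin (m + 1))).measure_preimage hS.nullMeasurableSet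
  have hS' : MeasurableSet (WithLp.toLp 2 ⁻¹' S : Set (Fin (m + 1) → ℝ)) :=
    (PiLp.volume_preserving_toLp (Fin (m + 1))).measurable hS
  have h2 := (volume_preserving_piFinSuccAbove (fun _ : Fin (m + 1) => ℝ) 0).symm.measure_preimage
    hS'.nullMeasurableSet
  rw [← h1, ← h2]
  have hS'' := (volume_preserving_piFinSuccAbove (fun _ : Fin (m + 1) => ℝ) 0).symm.measurable hS'
  rw [Measure.volume_eq_prod, Measure.prod_apply hS'']
  refine lintegral_congr fun t => congrArg _ (Set.ext fun y => ?_)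
  simp [MeasurableEquiv.piFinSuccAbove, Fin.insertNthEquiv]

/-- The tube around the line with direction `(1, j / 2 ^ n)`, translated so that all coordinates of
the slope compress. The coordinate `0` is the height. -/
def besicovitchTube (m n : ℕ) (j : Fin m → Fin (2 ^ n)) : Set (EuclideanSpace ℝ (Fin (m + 1))) :=
  {x | x 0 ∈ Icc (0 : ℝ) (1 / 2) ∧ ∀ i : Fin m, x i.succ ∈
    Icc (x 0 * ((j i : ℕ) / 2 ^ n) + besicovitchShift n (j i) - (2 ^ n)⁻¹)
      (x 0 * ((j i : ℕ) / 2 ^ n) + besicovitchShift n (j i) + (2 ^ n)⁻¹)}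

theorem measurableSet_besicovitchTube (m n : ℕ) (j : Fin m → Fin (2 ^ n)) :
    MeasurableSet (besicovitchTube m n j) := by
  refine IsClosed.measurableSet ?_
  simp only [besicovitchTube, mem_Icc, ofPred_and, ofPred_forall]
  refine IsClosed.inter (IsClosed.inter ?_ ?_) (isClosed_iInter fun i => IsClosed.inter ?_ ?_)
  all_goals exact isClosed_le (by fun_prop) (by fun_prop)

theorem volume_besicovitchTube (m n : ℕ) (j : Fin m → Fin (2 ^ n)) :
    volume (besicovitchTube m n j) = ENNReal.ofReal ((2 * (2 ^ n)⁻¹) ^ m / 2) := by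
  rw [volume_euclidean_eq_lintegral_slice (measurableSet_besicovitchTube m n j)]
  have h : ∀ t : ℝ, volume {y : Fin m → ℝ |
      WithLp.toLp 2 (Fin.cons t y : Fin (m + 1) → ℝ) ∈ besicovitchTube m n j} =
      (Icc (0 : ℝ) (1 / 2)).indicator (fun _ => ENNReal.ofReal ((2 * (2 ^ n)⁻¹) ^ m)) t := by
    intro t
    by_cases ht : t ∈ Icc (0 : ℝ) (1 / 2)
    · rw [indicator_of_mem ht]
      have : {y : Fin m → ℝ |
          WithLp.toLp 2 (Fin.cons t y : Fin (m + 1) → ℝ) ∈ besicovitchTube m n j} =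
          univ.pi fun i => Icc (t * ((j i : ℕ) / 2 ^ n) + besicovitchShift n (j i) - (2 ^ n)⁻¹)
            (t * ((j i : ℕ) / 2 ^ n) + besicovitchShift n (j i) + (2 ^ n)⁻¹) := by
        ext y
        simp only [besicovitchTube, mem_ofPred_eq, Fin.cons_zero, Fin.cons_succ, mem_univ_pi]
        exact and_iff_right ht
      rw [this, volume_pi_pi]
      simp only [Real.volume_Icc]
      rw [Finset.prod_congr rfl fun i _ => by rw [show ∀ a b : ℝ, a + b - (a - b) = 2 * b by
        intro a b; ring], Finset.prod_const, Finset.card_univ, Fintype.card_fin,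
        ENNReal.ofReal_pow (by positivity)]
    · rw [indicator_of_notMem ht]
      convert measure_empty (μ := (volume : Measure (Fin m → ℝ)))
      ext y
      simp only [besicovitchTube, mem_ofPred_eq, Fin.cons_zero, mem_empty_iff_false, iff_false]
      exact fun h => ht h.1
  simp only [h]
  rw [lintegral_indicator measurableSet_Icc, setLIntegral_const, Real.volume_Icc,
    ← ENNReal.ofReal_mul (by positivity)]
  congr 1
  ring

/-- The union of the tubes is small, since each of its slices is contained in a power of a slice
of the planar configuration. -/
theorem volume_iUnion_besicovitchTube_le (m : ℕ) {N : ℕ} (hN : 0 < N) :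
    volume (⋃ j, besicovitchTube m (2 * N) j) ≤ ENNReal.ofReal ((3 / N) ^ m) := by
  rw [volume_euclidean_eq_lintegral_slice
    (MeasurableSet.iUnion fun j => measurableSet_besicovitchTube m (2 * N) j)]
  have h : ∀ t : ℝ, volume {y : Fin m → ℝ |
      WithLp.toLp 2 (Fin.cons t y : Fin (m + 1) → ℝ) ∈ ⋃ j, besicovitchTube m (2 * N) j} ≤
      (Icc (0 : ℝ) (1 / 2)).indicator (fun _ => ENNReal.ofReal ((3 / N) ^ m)) t := by
    intro t
    by_cases ht : t ∈ Icc (0 : ℝ) (1 / 2)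
    · rw [indicator_of_mem ht]
      calc _ ≤ volume (univ.pi fun _ : Fin m => besicovitchSlice (2 * N) t) := by
            refine measure_mono fun y hy => ?_
            obtain ⟨j, hj⟩ := mem_iUnion.1 hy
            exact fun i _ => mem_iUnion.2 ⟨j i, hj.2 i⟩
        _ = volume (besicovitchSlice (2 * N) t) ^ m := by simp [volume_pi_pi]
        _ ≤ ENNReal.ofReal (3 / N) ^ m := by
            gcongr
            exact volume_besicovitchSlice_le hN ht
        _ = _ := by rw [ENNReal.ofReal_pow (by positivity)]
    · rw [indicator_of_notMem ht, nonpos_iff_eq_zero]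
      convert measure_empty (μ := (volume : Measure (Fin m → ℝ)))
      ext y
      simp only [mem_ofPred_eq, mem_empty_iff_false, iff_false, mem_iUnion, not_exists]
      exact fun j hj => ht hj.1
  refine (lintegral_mono h).trans ?_
  rw [lintegral_indicator measurableSet_Icc, setLIntegral_const, Real.volume_Icc]
  refine mul_le_of_le_one_right' ?_
  rw [ENNReal.ofReal_le_one]
  norm_num

/-! ### Caps dual to the tubes -/

/-- The part of the unit sphere seen from the origin through the dyadic cube with corner
`j / 2 ^ n` and side `2⁻ⁿ` in the hyperplane `x₀ = 1`. -/
def dyadicCap (m n : ℕ) (j : Fin m → Fin (2 ^ n)) : Set (UnitSphere (m + 1)) :=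
  {ω | 0 < ω.1 0 ∧ ∀ i : Fin m, ω.1 i.succ ∈
    Ico (ω.1 0 * ((j i : ℕ) / 2 ^ n)) (ω.1 0 * (((j i : ℕ) + 1) / 2 ^ n))}

/-- The open part of the sphere that the caps cover at every scale. -/
def coneRegion (m : ℕ) : Set (UnitSphere (m + 1)) :=
  {ω | 0 < ω.1 0 ∧ ∀ i : Fin m, 0 < ω.1 i.succ ∧ ω.1 i.succ < ω.1 0}

theorem measurableSet_dyadicCap (m n : ℕ) (j : Fin m → Fin (2 ^ n)) :
    MeasurableSet (dyadicCap m n j) := by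
  simp only [dyadicCap, mem_Ico, ofPred_and, ofPred_forall]
  refine MeasurableSet.inter ?_ (MeasurableSet.iInter fun i => MeasurableSet.inter ?_ ?_)
  · exact (isOpen_lt (by fun_prop) (by fun_prop)).measurableSet
  · exact (isClosed_le (by fun_prop) (by fun_prop)).measurableSet
  · exact (isOpen_lt (by fun_prop) (by fun_prop)).measurableSet

theorem dyadicCap_disjoint {m n : ℕ} {j l : Fin m → Fin (2 ^ n)} (hjl : j ≠ l) :
    Disjoint (dyadicCap m n j) (dyadicCap m n l) := by
  rw [disjoint_left]
  intro ω hj hl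
  refine hjl (funext fun i => Fin.ext ?_)
  have h2 : (0 : ℝ) < 2 ^ n := by positivity
  have key : ∀ a b : ℕ, ω.1 0 * ((a : ℝ) / 2 ^ n) < ω.1 0 * (((b : ℝ) + 1) / 2 ^ n) → a ≤ b := by
    intro a b hab
    have h3 := lt_of_mul_lt_mul_left hab hj.1.le
    rw [div_lt_div_iff_of_pos_right h2] at h3
    exact Nat.lt_succ_iff.1 (by exact_mod_cast h3)
  exact le_antisymm (key _ _ ((hj.2 i).1.trans_lt (hl.2 i).2))
    (key _ _ ((hl.2 i).1.trans_lt (hj.2 i).2))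

theorem coneRegion_subset_iUnion_dyadicCap (m n : ℕ) :
    coneRegion m ⊆ ⋃ j, dyadicCap m n j := by
  intro ω hω
  have h2 : (0 : ℝ) < 2 ^ n := by positivity
  have hu : ∀ i : Fin m, 0 ≤ ω.1 i.succ / ω.1 0 * 2 ^ n := fun i => by
    have := (hω.2 i).1
    have := hω.1
    positivity
  have hlt : ∀ i : Fin m, ⌊ω.1 i.succ / ω.1 0 * 2 ^ n⌋₊ < 2 ^ n := fun i => by
    rw [Nat.floor_lt (hu i)]
    push_cast
    exact mul_lt_of_lt_one_left h2 ((div_lt_one hω.1).2 (hω.2 i).2)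
  refine mem_iUnion.2 ⟨fun i => ⟨_, hlt i⟩, hω.1, fun i => ?_⟩
  have h3 := Nat.floor_le (hu i)
  have h4 := Nat.lt_floor_add_one (ω.1 i.succ / ω.1 0 * 2 ^ n)
  have h5 : ω.1 i.succ = ω.1 0 * (ω.1 i.succ / ω.1 0 * 2 ^ n / 2 ^ n) := by
    have := hω.1.ne'
    field_simp
  rw [mem_Ico]
  constructor
  · conv_rhs => rw [h5]
    have := hω.1.le
    gcongr
  · conv_lhs => rw [h5]
    have := hω.1
    gcongr

theorem surfaceMeasure_real_coneRegion_pos (m : ℕ) :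
    0 < (surfaceMeasure (m + 1)).real (coneRegion m) := by
  have : IsFiniteMeasure (surfaceMeasure (m + 1)) := by unfold surfaceMeasure; infer_instance
  have : (surfaceMeasure (m + 1)).IsOpenPosMeasure := by unfold surfaceMeasure; infer_instance
  rw [measureReal_def, ENNReal.toReal_pos_iff]
  refine ⟨IsOpen.measure_pos _ ?_ ?_, measure_lt_top _ _⟩
  · simp only [coneRegion, ofPred_and, ofPred_forall]
    refine IsOpen.inter ?_ (isOpen_iInter_of_finite fun i => IsOpen.inter ?_ ?_)
    all_goals exact isOpen_lt (by fun_prop) (by fun_prop)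
  · set v : EuclideanSpace ℝ (Fin (m + 1)) :=
      WithLp.toLp 2 (Fin.cons 2 (fun _ => 1) : Fin (m + 1) → ℝ) with hv
    have hv0 : v ≠ 0 := by
      intro h
      have := congrArg (fun w : EuclideanSpace ℝ (Fin (m + 1)) => w 0) h
      simp [hv] at this
    have hpos : 0 < ‖v‖⁻¹ := by positivity
    refine ⟨⟨‖v‖⁻¹ • v, ?_⟩, ?_, fun i => ⟨?_, ?_⟩⟩
    · rw [mem_sphere_zero_iff_norm, norm_smul, norm_inv, norm_norm,
        inv_mul_cancel₀ (norm_ne_zero_iff.2 hv0)]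
    · simp [hv, -norm_pos_iff] at hpos ⊢
      exact hpos
    · simp [hv, -norm_pos_iff] at hpos ⊢
      exact hpos
    · change ‖v‖⁻¹ * (1 : ℝ) < ‖v‖⁻¹ * 2
      linarith

theorem norm_normalize_sub_normalize_le {E : Type*} [NormedAddCommGroup E] [NormedSpace ℝ E]
    {u v : E} (hu : 1 ≤ ‖u‖) (hv : 1 ≤ ‖v‖) :
    ‖‖u‖⁻¹ • u - ‖v‖⁻¹ • v‖ ≤ 2 * ‖u - v‖ := by
  have hu0 : (0 : ℝ) < ‖u‖ := by linarith
  have hv0 : (0 : ℝ) < ‖v‖ := by linarith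
  have h : ‖u‖⁻¹ • u - ‖v‖⁻¹ • v = ‖u‖⁻¹ • ((u - v) + ((‖v‖ - ‖u‖) * ‖v‖⁻¹) • v) := by
    rw [smul_add, smul_sub, smul_smul]
    have : ‖u‖⁻¹ * ((‖v‖ - ‖u‖) * ‖v‖⁻¹) = ‖u‖⁻¹ - ‖v‖⁻¹ := by field_simp
    rw [this, sub_smul]
    abel
  rw [h, norm_smul, norm_inv, norm_norm]
  calc ‖u‖⁻¹ * ‖(u - v) + ((‖v‖ - ‖u‖) * ‖v‖⁻¹) • v‖
      ≤ 1 * (‖u - v‖ + ‖u - v‖) := by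
        gcongr
        · exact inv_le_one_of_one_le₀ hu
        · refine (norm_add_le _ _).trans (add_le_add_right ?_ _)
          rw [norm_smul, norm_mul, norm_inv, norm_norm, mul_assoc, inv_mul_cancel₀ hv0.ne',
            mul_one, Real.norm_eq_abs, norm_sub_rev u v]
          exact abs_norm_sub_norm_le v u
    _ = 2 * ‖u - v‖ := by ring

/-- The inner product with `v` is stationary on the unit sphere at the direction of `v`. -/
theorem abs_inner_sub_normalize {E : Type*} [NormedAddCommGroup E] [InnerProductSpace ℝ E]
    {v ω : E} (hv : v ≠ 0) (hω : ‖ω‖ = 1) :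
    |inner ℝ v (ω - ‖v‖⁻¹ • v)| = ‖v‖ * ‖ω - ‖v‖⁻¹ • v‖ ^ 2 / 2 := by
  have hv0 : ‖v‖ ≠ 0 := norm_ne_zero_iff.2 hv
  have h : inner ℝ v (ω - ‖v‖⁻¹ • v) = -(‖v‖ * ‖ω - ‖v‖⁻¹ • v‖ ^ 2 / 2) := by
    rw [norm_sub_sq_real, hω, norm_smul, norm_inv, norm_norm, inv_mul_cancel₀ hv0,
      inner_smul_right, inner_sub_right, inner_smul_right, real_inner_self_eq_norm_sq,
      real_inner_comm v ω]
    field_simp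
    ring
  rw [h, abs_neg, abs_of_nonneg (by positivity)]

theorem norm_le_of_abs_apply_le {k : ℕ} {v : EuclideanSpace ℝ (Fin k)} {B : ℝ} (hB : 0 ≤ B)
    (h : ∀ i, |v i| ≤ B) : ‖v‖ ≤ k * B := by
  refine abs_le_of_sq_le_sq' ?_ (by positivity) |>.2
  rw [EuclideanSpace.real_norm_sq_eq]
  calc ∑ i, v i ^ 2 ≤ ∑ _i : Fin k, B ^ 2 := by
        refine Finset.sum_le_sum fun i _ => ?_
        rw [← sq_abs]
        have := h i
        gcongr
    _ = k * B ^ 2 := by simp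
    _ ≤ (k * B) ^ 2 := by
        rw [mul_pow]
        gcongr
        exact_mod_cast Nat.le_self_pow two_ne_zero k

/-- The dilation factor that turns the tubes of width `2⁻ⁿ` into sets dual to the caps: it is
comparable to `4ⁿ`. -/
def tubeScale (m n : ℕ) : ℝ := 4 ^ n / (3 * ((m : ℝ) + 1) ^ 3)

theorem tubeScale_pos (m n : ℕ) : 0 < tubeScale m n := by
  unfold tubeScale
  positivity

/-- On the dilated tube, relative to its centre of translation, the phase is constant up to an
error at most one over the corresponding cap. Along the tube this holds because the phase is
stationary at the direction of the tube. -/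
theorem abs_inner_tube_cap_le_one {m n : ℕ} {j : Fin m → Fin (2 ^ n)}
    {x : EuclideanSpace ℝ (Fin (m + 1))} (hx : (tubeScale m n)⁻¹ • x ∈ besicovitchTube m n j)
    {ω : UnitSphere (m + 1)} (hω : ω ∈ dyadicCap m n j)
    {b v : EuclideanSpace ℝ (Fin (m + 1))}
    (hb : b = tubeScale m n • WithLp.toLp 2
      (Fin.cons 0 (fun i => besicovitchShift n (j i)) : Fin (m + 1) → ℝ))
    (hv : v = WithLp.toLp 2 (Fin.cons 1 (fun i => ((j i : ℕ) : ℝ) / 2 ^ n) : Fin (m + 1) → ℝ)) :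
    |inner ℝ (x - b) ((ω : EuclideanSpace ℝ (Fin (m + 1))) - ‖v‖⁻¹ • v)| ≤ 1 := by
  set L := tubeScale m n with hL
  have hL0 : 0 < L := tubeScale_pos m n
  set y := L⁻¹ • x with hy
  set t := y 0 with ht
  set δ : ℝ := (2 ^ n)⁻¹ with hδ
  have hδ0 : 0 < δ := by positivity
  set D : ℝ := ((m + 1 : ℕ) : ℝ) with hD
  have hD1 : 1 ≤ D := by rw [hD]; exact_mod_cast Nat.le_add_left 1 m
  set w : EuclideanSpace ℝ (Fin (m + 1)) := WithLp.toLp 2 (Fin.cons 0 (fun i =>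
    y i.succ - (t * ((j i : ℕ) / 2 ^ n) + besicovitchShift n (j i))) : Fin (m + 1) → ℝ) with hw
  have hw_norm : ‖w‖ ≤ D * δ := by
    refine norm_le_of_abs_apply_le hδ0.le fun i => ?_
    refine Fin.cases ?_ (fun i => ?_) i
    · simp [hw, hδ0.le]
    · simp only [hw, Fin.cons_succ]
      have := hx.2 i
      rw [abs_le]
      constructor <;> linarith [this.1, this.2]
  have hxb : x - b = L • (t • v + w) := by
    have hxy : x = L • y := by rw [hy, smul_inv_smul₀ hL0.ne']
    rw [hxy, hb, ← smul_sub]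
    congr 1
    ext i
    refine Fin.cases ?_ (fun i => ?_) i
    · simp [hv, hw, ht]
    · simp [hv, hw]
      ring
  have hv_apply : v 0 = 1 := by simp [hv]
  have hv1 : 1 ≤ ‖v‖ := by
    have := PiLp.norm_apply_le v 0
    rwa [hv_apply, norm_one] at this
  have hv2 : ‖v‖ ≤ D * 1 := by
    refine norm_le_of_abs_apply_le zero_le_one fun i => ?_
    refine Fin.cases ?_ (fun i => ?_) i
    · simp [hv]
    · simp only [hv, Fin.cons_succ]
      rw [abs_of_nonneg (by positivity), div_le_one (by positivity)]
      exact_mod_cast (j i).2.le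
  have hω1 : ‖(ω : EuclideanSpace ℝ (Fin (m + 1)))‖ = 1 := norm_eq_of_mem_sphere ω
  have hω0 : 0 < ω.1 0 := hω.1
  set z : EuclideanSpace ℝ (Fin (m + 1)) := (ω.1 0)⁻¹ • ω.1 with hz
  have hz_norm : ‖z‖ = (ω.1 0)⁻¹ := by
    rw [hz, norm_smul, hω1, mul_one, Real.norm_of_nonneg (by positivity)]
  have hz1 : 1 ≤ ‖z‖ := by
    have h1 := PiLp.norm_apply_le z 0
    have h2 : z 0 = 1 := by simp [hz, hω0.ne']
    rwa [h2, norm_one] at h1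
  have hzω : ‖z‖⁻¹ • z = ω.1 := by
    rw [hz_norm, inv_inv, hz, smul_inv_smul₀ hω0.ne']
  have hzv : ‖z - v‖ ≤ D * δ := by
    refine norm_le_of_abs_apply_le hδ0.le fun i => ?_
    refine Fin.cases ?_ (fun i => ?_) i
    · simp [hz, hv, hω0.ne', hδ0.le]
    · have h1 := (le_div_iff₀' hω0).2 (hω.2 i).1
      have h2 := (div_lt_iff₀' hω0).2 (hω.2 i).2
      rw [add_div, one_div] at h2
      simp only [hz, hv, PiLp.sub_apply, PiLp.smul_apply, Fin.cons_succ, smul_eq_mul,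
        ← div_eq_inv_mul]
      rw [abs_le]
      constructor <;> linarith
  have hdist : ‖ω.1 - ‖v‖⁻¹ • v‖ ≤ 2 * (D * δ) := by
    rw [← hzω]
    exact (norm_normalize_sub_normalize_le hz1 hv1).trans (by gcongr)
  have hv0 : v ≠ 0 := by
    rintro h
    rw [h, norm_zero] at hv1
    linarith
  have hLδ : L * δ ^ 2 * (3 * D ^ 3) = 1 := by
    rw [hL, tubeScale, hδ, hD]
    have : (4 : ℝ) ^ n = 2 ^ n * 2 ^ n := by rw [← mul_pow]; norm_num
    rw [this]
    push_cast
    field_simp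
  have ht0 : |t| ≤ 1 / 2 := abs_le.2 ⟨by linarith [hx.1.1], hx.1.2⟩
  calc |inner ℝ (x - b) (ω.1 - ‖v‖⁻¹ • v)|
      = L * |t * inner ℝ v (ω.1 - ‖v‖⁻¹ • v) + inner ℝ w (ω.1 - ‖v‖⁻¹ • v)| := by
        rw [hxb, real_inner_smul_left, inner_add_left, real_inner_smul_left, abs_mul,
          abs_of_pos hL0]
    _ ≤ L * (1 / 2 * (D * 1 * (2 * (D * δ)) ^ 2 / 2) + D * δ * (2 * (D * δ))) := by
        gcongr
        refine (abs_add_le _ _).trans (add_le_add ?_ ?_)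
        · rw [abs_mul, abs_inner_sub_normalize hv0 hω1]
          gcongr
        · exact (abs_real_inner_le_norm _ _).trans (by gcongr)
    _ = L * δ ^ 2 * (D ^ 3 + 2 * D ^ 2) := by ring
    _ ≤ L * δ ^ 2 * (3 * D ^ 3) := by
        have : D ^ 2 ≤ D ^ 3 := pow_le_pow_right₀ hD1 (by norm_num)
        gcongr
        linarith
    _ = 1 := hLδ

/-! ### Failure of the endpoint estimates -/

/-- Bounded functions adapted to the compressed tubes have extensions with a large square integral
over a small set. -/
theorem exists_concentrated_extension (m : ℕ) : ∃ c : ℝ, 0 < c ∧ ∀ N : ℕ, 0 < N →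
    ∃ L : ℝ, 0 < L ∧ ∃ K : Set (EuclideanSpace ℝ (Fin (m + 1))),
      volume K ≤ ENNReal.ofReal (L ^ (m + 1) * (3 / N) ^ m) ∧
      ∃ F : UnitSphere (m + 1) → ℂ, Measurable F ∧ (∀ ω, ‖F ω‖ ≤ 1) ∧
        ENNReal.ofReal (c * L) ≤
          ∫⁻ x in K, ENNReal.ofReal (‖extensionOp (m + 1) F x‖ ^ 2) := by
  have : IsFiniteMeasure (surfaceMeasure (m + 1)) := by unfold surfaceMeasure; infer_instance
  set S := (surfaceMeasure (m + 1)).real (coneRegion m) with hS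
  have hS0 : 0 < S := surfaceMeasure_real_coneRegion_pos m
  refine ⟨S ^ 2 / 8 * (2 / (3 * ((m : ℝ) + 1) ^ 3)) ^ m, by positivity, fun N hN => ?_⟩
  set n := 2 * N with hn
  set L := tubeScale m n with hL
  have hL0 : 0 < L := tubeScale_pos m n
  have hscale : ∀ T : Set (EuclideanSpace ℝ (Fin (m + 1))),
      volume ((fun x => L⁻¹ • x) ⁻¹' T) = ENNReal.ofReal (L ^ (m + 1)) * volume T := by
    intro T
    rw [Measure.addHaar_preimage_smul _ (by positivity)]
    simp [abs_of_pos hL0]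
  refine ⟨L, hL0, (fun x => L⁻¹ • x) ⁻¹' ⋃ j, besicovitchTube m n j, ?_, ?_⟩
  · rw [hscale, ENNReal.ofReal_mul (by positivity)]
    gcongr
    exact volume_iUnion_besicovitchTube_le m hN
  set b : (Fin m → Fin (2 ^ n)) → EuclideanSpace ℝ (Fin (m + 1)) := fun j =>
    L • WithLp.toLp 2 (Fin.cons 0 (fun i => besicovitchShift n (j i)) : Fin (m + 1) → ℝ) with hb
  set f : (Fin m → Fin (2 ^ n)) → UnitSphere (m + 1) → ℂ := fun j =>
    (dyadicCap m n j).indicator fun ω =>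
      Complex.exp (Complex.I * (inner ℝ (b j) (ω : EuclideanSpace ℝ (Fin (m + 1))) : ℝ)) with hf
  obtain ⟨F, hF, hF1, hFK⟩ := exists_signed_sum_extensionOp f
    (fun j => (Continuous.measurable (by fun_prop)).indicator (measurableSet_dyadicCap m n j))
    (fun j ω => by
      refine (norm_indicator_le_norm_self _ _).trans ?_
      rw [Complex.norm_exp]
      simp)
    (fun i j hij ω => by
      by_cases hω : ω ∈ dyadicCap m n i
      · exact Or.inr (indicator_of_notMem (disjoint_left.1 (dyadicCap_disjoint hij) hω) _)
      · exact Or.inl (indicator_of_notMem hω _))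
    ((fun x => L⁻¹ • x) ⁻¹' ⋃ j, besicovitchTube m n j) Finset.univ
  refine ⟨F, hF, hF1, le_trans ?_ hFK⟩
  set σ : (Fin m → Fin (2 ^ n)) → ℝ := fun j =>
    (surfaceMeasure (m + 1)).real (dyadicCap m n j) with hσ
  have hpiece : ∀ j, ENNReal.ofReal ((σ j / 2) ^ 2 *
      (L ^ (m + 1) * ((2 * (2 ^ n)⁻¹) ^ m / 2))) ≤
      ∫⁻ x in (fun x => L⁻¹ • x) ⁻¹' ⋃ j, besicovitchTube m n j,
        ENNReal.ofReal (‖extensionOp (m + 1) (f j) x‖ ^ 2) := by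
    intro j
    calc _ = ∫⁻ x in (fun x => L⁻¹ • x) ⁻¹' besicovitchTube m n j,
          ENNReal.ofReal ((σ j / 2) ^ 2) := by
          rw [setLIntegral_const, hscale, volume_besicovitchTube,
            ← ENNReal.ofReal_mul (by positivity), ← ENNReal.ofReal_mul (by positivity)]
      _ ≤ ∫⁻ x in (fun x => L⁻¹ • x) ⁻¹' besicovitchTube m n j,
          ENNReal.ofReal (‖extensionOp (m + 1) (f j) x‖ ^ 2) := by
          refine setLIntegral_mono'
            ((measurableSet_besicovitchTube m n j).preimage (by fun_prop)) fun x hx => ?_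
          refine ENNReal.ofReal_le_ofReal (pow_le_pow_left₀ (by positivity) ?_ 2)
          exact measureReal_le_norm_extensionOp_modulated (measurableSet_dyadicCap m n j) (b j) x _
            fun ω hω => abs_inner_tube_cap_le_one hx hω rfl rfl
      _ ≤ _ := lintegral_mono_set (preimage_mono (subset_iUnion _ j))
  refine le_trans ?_ (Finset.sum_le_sum fun j _ => hpiece j)
  rw [← ENNReal.ofReal_sum_of_nonneg fun j _ => by positivity]
  apply ENNReal.ofReal_le_ofReal
  have hSσ : S ≤ ∑ j, σ j := by
    calc S ≤ (surfaceMeasure (m + 1)).real (⋃ j, dyadicCap m n j) :=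
          measureReal_mono (coneRegion_subset_iUnion_dyadicCap m n)
      _ ≤ ∑ j, σ j := measureReal_iUnion_fintype_le _
  have hCS : S ^ 2 ≤ ((2 : ℝ) ^ n) ^ m * ∑ j, σ j ^ 2 := by
    calc S ^ 2 ≤ (∑ j, σ j) ^ 2 := by gcongr
      _ ≤ _ := sq_sum_le_card_mul_sum_sq
      _ = _ := by simp
  have hLn : L * ((2 : ℝ) ^ n)⁻¹ * ((2 : ℝ) ^ n)⁻¹ = 1 / (3 * ((m : ℝ) + 1) ^ 3) := by
    have : (4 : ℝ) ^ n = 2 ^ n * 2 ^ n := by rw [← mul_pow]; norm_num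
    rw [hL, tubeScale, this]
    field_simp
  calc S ^ 2 / 8 * (2 / (3 * ((m : ℝ) + 1) ^ 3)) ^ m * L
      = S ^ 2 * ((((2 : ℝ) ^ n)⁻¹) ^ m * (L ^ (m + 1) * ((2 * (2 ^ n)⁻¹) ^ m / 2)) / 4) := by
        rw [div_eq_mul_one_div 2, ← hLn]
        simp only [mul_pow, pow_succ]
        ring
    _ ≤ (((2 : ℝ) ^ n) ^ m * ∑ j, σ j ^ 2) *
        ((((2 : ℝ) ^ n)⁻¹) ^ m * (L ^ (m + 1) * ((2 * (2 ^ n)⁻¹) ^ m / 2)) / 4) := by gcongr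
    _ = (((2 : ℝ) ^ n) ^ m * (((2 : ℝ) ^ n)⁻¹) ^ m) * (∑ j, σ j ^ 2) *
        (L ^ (m + 1) * ((2 * (2 ^ n)⁻¹) ^ m / 2) / 4) := by ring
    _ = ∑ j, (σ j / 2) ^ 2 * (L ^ (m + 1) * ((2 * (2 ^ n)⁻¹) ^ m / 2)) := by
        rw [← mul_pow, mul_inv_cancel₀ (by positivity), one_pow, one_mul, Finset.sum_mul]
        exact Finset.sum_congr rfl fun j _ => by ring

/-- No bound on the `L^{2d/(d-1),∞}` norm of the extension, `d = m + 1`, holds uniformly over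
functions bounded by one. -/
theorem exists_norm_le_one_lt_eLorentzNorm_extensionOp {m : ℕ} (hm : 1 ≤ m) (A : ℝ≥0) :
    ∃ F : UnitSphere (m + 1) → ℂ, Measurable F ∧ (∀ ω, ‖F ω‖ ≤ 1) ∧
      (A : ℝ≥0∞) < eLorentzNorm (extensionOp (m + 1) F) (2 * ((m : ℝ) + 1) / m) ∞ volume := by
  by_contra! hA
  have hm0 : (0 : ℝ) < m := by exact_mod_cast hm
  set q : ℝ := 2 * ((m : ℝ) + 1) / m with hq
  have hq2 : q - 2 = 2 / m := by rw [hq]; field_simp; ring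
  have hq2' : 2 < q := by
    have : 0 < 2 / (m : ℝ) := by positivity
    linarith
  obtain ⟨c, hc, hN⟩ := exists_concentrated_extension m
  -- The height `τ L ^ (-m / 2)` is the one at which both parts of the square integral scale
  -- like `L`.
  have hkey : ∀ τ : ℝ, 0 < τ → ∀ N : ℕ, 0 < N →
      c ≤ τ ^ 2 * (3 / N) ^ m + m * (A : ℝ) ^ q * τ ^ (-(2 / (m : ℝ))) := by
    intro τ hτ N hN0
    obtain ⟨L, hL, K, hK, F, hF, hF1, hFK⟩ := hN N hN0
    have hweak := setLIntegral_norm_sq_le_of_weak (continuous_extensionOp hF hF1).measurable hq2'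
      (A := (A : ℝ) ^ q) (s₀ := τ * L ^ (-(m : ℝ) / 2)) (by positivity) (by positivity)
      (fun s hs => measure_lt_norm_le_of_eLorentzNorm_top_le (by linarith) (hA F hF hF1) hs) K
    have hsq : (τ * L ^ (-(m : ℝ) / 2)) ^ 2 * L ^ (m + 1) = τ ^ 2 * L := by
      rw [mul_pow, ← Real.rpow_natCast (L ^ (-(m : ℝ) / 2)) 2, ← Real.rpow_mul hL.le, mul_assoc,
        ← Real.rpow_natCast L (m + 1), ← Real.rpow_add hL]
      conv_rhs => rw [← Real.rpow_one L]
      congr 2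
      push_cast
      ring
    have htail : (τ * L ^ (-(m : ℝ) / 2)) ^ (2 - q) = τ ^ (-(2 / (m : ℝ))) * L := by
      rw [← neg_sub q 2, hq2, Real.mul_rpow hτ.le (by positivity), ← Real.rpow_mul hL.le]
      conv_rhs => rw [← Real.rpow_one L]
      congr 2
      field_simp
    have hreal : ENNReal.ofReal (c * L) ≤ ENNReal.ofReal (τ ^ 2 * L * (3 / N) ^ m +
        m * (A : ℝ) ^ q * (τ ^ (-(2 / (m : ℝ))) * L)) := by
      refine (hFK.trans hweak).trans ?_
      rw [ENNReal.ofReal_add (by positivity) (by positivity)]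
      refine add_le_add ?_ (le_of_eq ?_)
      · rw [← hsq, mul_assoc, ENNReal.ofReal_mul (by positivity)]
        gcongr
      · rw [htail, hq2, div_div_cancel₀ two_ne_zero]
    rw [ENNReal.ofReal_le_ofReal_iff (by positivity)] at hreal
    refine le_of_mul_le_mul_right (hreal.trans_eq ?_) hL
    ring
  have hkey2 : ∀ τ : ℝ, 0 < τ → c ≤ m * (A : ℝ) ^ q * τ ^ (-(2 / (m : ℝ))) := by
    intro τ hτ
    have hlim : Filter.Tendsto (fun N : ℕ =>
        τ ^ 2 * (3 / (N : ℝ)) ^ m + m * (A : ℝ) ^ q * τ ^ (-(2 / (m : ℝ)))) Filter.atTop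
        (nhds (τ ^ 2 * 0 ^ m + m * (A : ℝ) ^ q * τ ^ (-(2 / (m : ℝ))))) :=
      (((tendsto_const_div_atTop_nhds_zero_nat 3).pow m).const_mul _).add_const _
    rw [zero_pow (by omega), mul_zero, zero_add] at hlim
    refine ge_of_tendsto hlim ?_
    filter_upwards [Filter.eventually_gt_atTop 0] with N hN0
    exact hkey τ hτ N hN0
  have hlim : Filter.Tendsto (fun τ : ℝ => m * (A : ℝ) ^ q * τ ^ (-(2 / (m : ℝ)))) Filter.atTop
      (nhds (m * (A : ℝ) ^ q * 0)) :=
    (tendsto_rpow_neg_atTop (by positivity)).const_mul _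
  rw [mul_zero] at hlim
  refine hc.not_ge (ge_of_tendsto hlim ?_)
  filter_upwards [Filter.eventually_gt_atTop 0] with τ hτ
  exact hkey2 τ hτ

theorem not_lorentzExtensionEstimate {m : ℕ} (hm : 1 ≤ m) {p : ℝ} (hp : 0 < p) :
    ¬ LorentzExtensionEstimate (m + 1) p (2 * ((m : ℝ) + 1) / m) := by
  rintro ⟨C, hC⟩
  have : IsFiniteMeasure (surfaceMeasure (m + 1)) := by unfold surfaceMeasure; infer_instance
  set B : ℝ≥0∞ := ENNReal.ofReal p * surfaceMeasure (m + 1) univ ^ (1 / p) with hB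
  have hBtop : B ≠ ∞ := ENNReal.mul_ne_top ENNReal.ofReal_ne_top
    (ENNReal.rpow_ne_top_of_nonneg (by positivity) (measure_ne_top _ _))
  obtain ⟨F, hF, hF1, hlt⟩ := exists_norm_le_one_lt_eLorentzNorm_extensionOp hm (C * B.toNNReal)
  have hFB : eLorentzNorm F p 1 (surfaceMeasure (m + 1)) ≤ B :=
    eLorentzNorm_one_le_of_norm_le_one hp hF1
  refine hlt.not_ge ((hC F ⟨hF.aestronglyMeasurable, hFB.trans_lt hBtop.lt_top⟩).trans ?_)
  rw [ENNReal.coe_mul, ENNReal.coe_toNNReal hBtop]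
  gcongr

theorem not_boundedExtensionEstimate {m : ℕ} (hm : 1 ≤ m) :
    ¬ BoundedExtensionEstimate (m + 1) (2 * ((m : ℝ) + 1) / m) := by
  rintro ⟨C, hC⟩
  obtain ⟨F, hF, hF1, hlt⟩ := exists_norm_le_one_lt_eLorentzNorm_extensionOp hm C
  have hFle : eLpNorm F ∞ (surfaceMeasure (m + 1)) ≤ 1 := by
    refine (eLpNorm_le_of_ae_bound (C := 1) (Filter.Eventually.of_forall hF1)).trans ?_
    simp
  refine hlt.not_ge ((hC F ⟨hF.aestronglyMeasurable, hFle.trans_lt ENNReal.one_lt_top⟩).trans ?_)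
  exact mul_le_of_le_one_right' hFle

end

theorem mainTheorem7 (d : ℕ) (hd : 2 ≤ d) :
    (∀ p : ℝ, 2 * (d : ℝ) / ((d : ℝ) - 1) < p →
      ¬ LorentzExtensionEstimate d p (2 * (d : ℝ) / ((d : ℝ) - 1))) ∧
    ¬ BoundedExtensionEstimate d (2 * (d : ℝ) / ((d : ℝ) - 1)) ∧
    ¬ LorentzExtensionEstimate d (2 * (d : ℝ) / ((d : ℝ) - 1))
      (2 * (d : ℝ) / ((d : ℝ) - 1)) := by
  obtain ⟨m, rfl⟩ := Nat.exists_eq_add_of_le' (show 1 ≤ d by omega)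
  have hm : 1 ≤ m := by omega
  have hm0 : (0 : ℝ) < m := by exact_mod_cast hm
  have hq : 2 * ((m + 1 : ℕ) : ℝ) / (((m + 1 : ℕ) : ℝ) - 1) = 2 * ((m : ℝ) + 1) / m := by
    push_cast
    rw [add_sub_cancel_right]
  have hq0 : 0 < 2 * ((m : ℝ) + 1) / m := by positivity
  rw [hq]
  exact ⟨fun p hp => not_lorentzExtensionEstimate hm (hq0.trans hp),
    not_boundedExtensionEstimate hm, not_lorentzExtensionEstimate hm hq0⟩
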